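/- Let $A$ be a (not necessarily unital) $C^*$-algebra with multiplier algebra $M(A)$. All Hilbert $C^*$-modules are right modules; a bounded $A$-morphism $T:\mathcal M\to\mathcal N$ of Hilbert $A$-modules is \emph{adjointable} if there is a bounded $A$-morphism $T^*:\mathcal N\to\mathcal M$ with $\langle Tx,y\rangle=\langle x,T^*y\rangle$ for all $x,y$, and \emph{locally adjointable} if $T\circ\gamma:A\to\mathcal N$ is adjointable for every adjointable $\gamma:A\to\mathcal M$. Let $\ell_2(A)$ be the standard Hilbert module of all sequences $a=(a_i)$ in $A$ with $\sum_i a_i^*a_i$ norm-convergent, with $\langle a,b\rangle=\sum_i a_i^*b_i$, coordinate projections $\pi_k:\ell_2(A)\to A$ and coordinate inclusions $\iota_i:A\to\ell_2(A)$. Let $M(\ell_2(A))$ be its multiplier module, i.e. the Hilbert $M(A)$-module of all adjointable maps $A\to\ell_2(A)$ with $\langle r_1,r_2\rangle=r_1^*r_2\in M(A)$ and action $r\cdot m=r\circ m$, and let $M(\ell_2(A))'$ be the set of all bounded $M(A)$-morphisms $\varphi:M(\ell_2(A))\to M(A)$; such a $\varphi$ is identified with the sequence of its coefficients $\varphi(\iota_i)\in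 M(A)$, each regarded as the left multiplier $a\mapsto\varphi(\iota_i)a$ of $A$. Then: 1) For every Hilbert $A$-module $\mathcal M$, a bounded $A$-morphism $F:\mathcal M\to\ell_2(A)$ is locally adjointable if and only if all its projections $\pi_k\circ F:\mathcal M\to A$, $k\in\mathbb N$, are locally adjointable. 2) A bounded $A$-endomorphism $F$ of $\ell_2(A)$ is locally adjointable if and only if each of its matrix rows $(F_{ki})_{i\in\mathbb N}$, $F_{ki}=\pi_k\circ F\circ\iota_i:A\to A$, belongs to $M(\ell_2(A))'$; that is, for every $k$ there is $\varphi_k\in M(\ell_2(A))'$ with $\varphi_k(\iota_i)\,a=F_{ki}(a)$ for all $i\in\mathbb N$ and $a\in A$. -/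

import Mathlib

open scoped RightActions MultiplierAlgebra InnerProductSpace
open MulOpposite

noncomputable section

set_option linter.unusedSectionVars false

namespace HilbertModule

universe u v w

/-- A right Hilbert module over `A` is a (left) `CStarModule` over `Aᵐᵒᵖ`; this is its `A`-valued
inner product. With `x <• a = op a • x` it satisfies `⟨x, y <• a⟩ = ⟨x, y⟩ * a`. -/
def rinner (A : Type u) {E : Type v} [Inner Aᵐᵒᵖ E] (x y : E) : A := unop (inner Aᵐᵒᵖ x y)

section Basic

variable {A : Type u} [NonUnitalCStarAlgebra A] [PartialOrder A] [StarOrderedRing A]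
variable {E : Type v} [NormedAddCommGroup E] [NormedSpace ℂ E] [SMul Aᵐᵒᵖ E] [CStarModule Aᵐᵒᵖ E]

theorem rinner_add_right (x y z : E) : rinner A x (y + z) = rinner A x y + rinner A x z := by
  simp [rinner]

theorem rinner_sub_right (x y z : E) : rinner A x (y - z) = rinner A x y - rinner A x z := by
  simp [rinner]

theorem rinner_smul_right (c : ℂ) (x y : E) : rinner A x (c • y) = c • rinner A x y := by
  simp [rinner]

theorem rinner_rsmul_right (x y : E) (a : A) : rinner A x (y <• a) = rinner A x y * a := by
  simp [rinner]

theorem star_rinner (x y : E) : star (rinner A x y) = rinner A y x := by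
  simp [rinner, ← unop_star]

theorem rinner_add_left (x y z : E) : rinner A (x + y) z = rinner A x z + rinner A y z := by
  simp [rinner]

theorem rinner_sub_left (x y z : E) : rinner A (x - y) z = rinner A x z - rinner A y z := by
  simp [rinner]

theorem rinner_self_nonneg (x : E) : 0 ≤ rinner A x x :=
  (CStarModule.inner_self_nonneg : 0 ≤ inner Aᵐᵒᵖ x x)

theorem rinner_self_eq_zero {x : E} : rinner A x x = 0 ↔ x = 0 := by
  simp [rinner, CStarModule.inner_self]

theorem norm_sq_eq_rinner (x : E) : ‖x‖ ^ 2 = ‖rinner A x x‖ :=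
  CStarModule.norm_sq_eq Aᵐᵒᵖ

theorem norm_rinner_le (x y : E) : ‖rinner A x y‖ ≤ ‖x‖ * ‖y‖ :=
  CStarModule.norm_inner_le (A := Aᵐᵒᵖ) E

theorem continuous_rinner : Continuous fun p : E × E => rinner A p.1 p.2 :=
  continuous_unop.comp (CStarModule.continuous_inner (A := Aᵐᵒᵖ))

theorem ext_rinner_left {x y : E} (h : ∀ z : E, rinner A x z = rinner A y z) : x = y := by
  rw [← sub_eq_zero, ← rinner_self_eq_zero (A := A), rinner_sub_left, h, sub_self]

theorem ext_rinner_right {x y : E} (h : ∀ z : E, rinner A z x = rinner A z y) : x = y := by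
  rw [← sub_eq_zero, ← rinner_self_eq_zero (A := A), rinner_sub_right, h, sub_self]

end Basic

/-- A C⋆-algebra as a right Hilbert module over itself, with `⟨a, b⟩ = a⋆ b`. -/
instance instSelf (A : Type u) [NonUnitalCStarAlgebra A] [PartialOrder A] [StarOrderedRing A] :
    CStarModule Aᵐᵒᵖ A where
  inner x y := op (star x * y)
  inner_add_right := by intros; simp [mul_add]
  inner_self_nonneg {x} := (star_mul_self_nonneg x : 0 ≤ star x * x)
  inner_self {x} := by simp
  inner_op_smul_right {a x y} := by
    induction a using MulOpposite.rec' with | _ a => simp [mul_assoc, ← op_mul]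
  inner_smul_right_complex {z x y} := congrArg op (mul_smul_comm z (star x) y)
  star_inner x y := by simp [← op_star]
  norm_eq_sqrt_norm_inner_self x := by
    rw [← sq_eq_sq₀ (norm_nonneg _) (Real.sqrt_nonneg _), Real.sq_sqrt (norm_nonneg _)]
    rw [norm_op, CStarRing.norm_star_mul_self, pow_two]

theorem rinner_self_def {A : Type u} [NonUnitalCStarAlgebra A] [PartialOrder A]
    [StarOrderedRing A] (a b : A) : rinner A a b = star a * b := rfl

/-- A bounded `A`-morphism (operator) `E → F` of right `A`-modules. -/
structure Operator (A : Type u) (E : Type v) (F : Type w) [NormedAddCommGroup E] [NormedSpace ℂ E]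
    [SMul Aᵐᵒᵖ E] [NormedAddCommGroup F] [NormedSpace ℂ F] [SMul Aᵐᵒᵖ F] extends E →L[ℂ] F where
  map_rsmul' : ∀ (x : E) (a : A), toFun (x <• a) = toFun x <• a

namespace Operator

instance (A : Type u) (E : Type v) (F : Type w) [NormedAddCommGroup E] [NormedSpace ℂ E]
    [SMul Aᵐᵒᵖ E] [NormedAddCommGroup F] [NormedSpace ℂ F] [SMul Aᵐᵒᵖ F] :
    CoeFun (Operator A E F) fun _ => E → F := ⟨fun T => T.toContinuousLinearMap⟩

/-- Composition of bounded `A`-morphisms. -/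
def comp {A : Type u} {E F G : Type*} [NormedAddCommGroup E] [NormedSpace ℂ E] [SMul Aᵐᵒᵖ E]
    [NormedAddCommGroup F] [NormedSpace ℂ F] [SMul Aᵐᵒᵖ F]
    [NormedAddCommGroup G] [NormedSpace ℂ G] [SMul Aᵐᵒᵖ G]
    (S : Operator A F G) (T : Operator A E F) : Operator A E G where
  toContinuousLinearMap := S.toContinuousLinearMap.comp T.toContinuousLinearMap
  map_rsmul' x a := (congrArg S (T.map_rsmul' x a)).trans (S.map_rsmul' _ a)

end Operator

section Adjointable

variable {A : Type u} [NonUnitalCStarAlgebra A] [PartialOrder A] [StarOrderedRing A]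
variable {E : Type v} [NormedAddCommGroup E] [NormedSpace ℂ E] [SMul Aᵐᵒᵖ E] [CStarModule Aᵐᵒᵖ E]
variable {F : Type w} [NormedAddCommGroup F] [NormedSpace ℂ F] [SMul Aᵐᵒᵖ F] [CStarModule Aᵐᵒᵖ F]

/-- `T` has an adjoint operator `S`: `⟨T x, y⟩ = ⟨x, S y⟩` for all `x`, `y`. -/
def IsAdjointable (T : Operator A E F) : Prop :=
  ∃ S : Operator A F E, ∀ (x : E) (y : F), rinner A (T x) y = rinner A x (S y)

/-- `T : E → F` is locally adjointable if `T ∘ γ` is adjointable for every adjointable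
`γ : A → E`. -/
def IsLocallyAdjointable (T : Operator A E F) : Prop :=
  ∀ γ : Operator A A E, IsAdjointable γ → IsAdjointable (T.comp γ)

theorem rsmul_of_adjoint {T : E → F} {S : F → E}
    (h : ∀ (x : E) (y : F), rinner A (T x) y = rinner A x (S y)) (y : F) (a : A) :
    S (y <• a) = S y <• a := by
  refine ext_rinner_right (A := A) fun x => ?_
  rw [← h, rinner_rsmul_right, rinner_rsmul_right, h]

theorem adjoint_symm {T : E → F} {S : F → E}
    (h : ∀ (x : E) (y : F), rinner A (T x) y = rinner A x (S y)) (y : F) (x : E) :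
    rinner A (S y) x = rinner A y (T x) := by
  rw [← star_rinner, ← h, star_rinner]

end Adjointable

/-! ### The standard Hilbert module `ℓ²(A)` -/

section StandardModule

variable {A : Type u} [NonUnitalCStarAlgebra A] [PartialOrder A] [StarOrderedRing A]

theorem summable_of_nonneg_of_le {f g : ℕ → A} (hf : ∀ i, 0 ≤ f i) (hfg : ∀ i, f i ≤ g i)
    (hg : Summable g) : Summable f := by
  rw [summable_iff_vanishing_norm] at hg ⊢
  intro ε hε
  obtain ⟨s, hs⟩ := hg ε hε
  exact ⟨s, fun t ht => lt_of_le_of_lt (CStarAlgebra.norm_le_norm_of_nonneg_of_le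
    (Finset.sum_nonneg fun i _ => hf i) (Finset.sum_le_sum fun i _ => hfg i)) (hs t ht)⟩

theorem star_add_mul_self_le (a b : A) :
    star (a + b) * (a + b) ≤ 2 • (star a * a + star b * b) := by
  have h := star_mul_self_nonneg (a - b)
  rw [← sub_nonneg]
  convert h using 1
  simp only [star_add, star_sub, add_mul, mul_add, sub_mul, mul_sub, two_nsmul]
  abel

variable (A) in
/-- Sequences `a` in `A` such that the series `∑ aᵢ⋆ aᵢ` converges in norm. -/
def squareSummable : Submodule ℂ (ℕ → A) where
  carrier := {a | Summable fun i => star (a i) * a i}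
  add_mem' {a b} ha hb := summable_of_nonneg_of_le (fun i => star_mul_self_nonneg _)
    (fun i => star_add_mul_self_le (a i) (b i)) ((ha.add hb).const_smul 2)
  zero_mem' := by simp
  smul_mem' c a ha := by
    have h : Summable fun i => (star c * c) • (star (a i) * a i) := ha.const_smul _
    refine h.congr fun i => ?_
    simp [smul_mul_smul_comm]

variable (A) in
/-- The standard Hilbert module `ℓ²(A)`. -/
def EllTwo : Type u := squareSummable A

namespace EllTwo

instance : AddCommGroup (EllTwo A) := inferInstanceAs (AddCommGroup (squareSummable A))

instance : Module ℂ (EllTwo A) := inferInstanceAs (Module ℂ (squareSummable A))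

/-- The underlying sequence of an element of `ℓ²(A)`. -/
def coord (a : EllTwo A) : ℕ → A := a.1

instance : CoeFun (EllTwo A) fun _ => ℕ → A := ⟨coord⟩

theorem summable_self (a : EllTwo A) : Summable fun i => star (a i) * a i := a.2

@[ext] theorem ext {a b : EllTwo A} (h : ∀ i, a i = b i) : a = b := Subtype.ext (funext h)

@[simp] theorem add_apply (a b : EllTwo A) (i : ℕ) : (a + b) i = a i + b i := rfl

@[simp] theorem sub_apply (a b : EllTwo A) (i : ℕ) : (a - b) i = a i - b i := rfl

@[simp] theorem zero_apply (i : ℕ) : (0 : EllTwo A) i = 0 := rfl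

@[simp] theorem smul_apply (c : ℂ) (a : EllTwo A) (i : ℕ) : (c • a) i = c • a i := rfl

theorem summable_inner (a b : EllTwo A) : Summable fun i => star (a i) * b i := by
  have h := (((summable_self (a + b)).sub (summable_self (a - b))).sub
    ((((summable_self (a + Complex.I • b)).sub
      (summable_self (a - Complex.I • b))).const_smul Complex.I))).const_smul (4⁻¹ : ℂ)
  refine h.congr fun i => ?_
  simp only [add_apply, sub_apply, smul_apply, star_add, star_sub, star_smul, add_mul, mul_add,
    sub_mul, mul_sub, smul_mul_assoc, mul_smul_comm, smul_add, smul_sub, smul_smul]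
  have hI : star Complex.I = -Complex.I := Complex.conj_I
  simp only [hI]
  have : Complex.I * Complex.I = -1 := Complex.I_mul_I
  match_scalars <;> grind

/-- The coordinatewise right action of `A` on `ℓ²(A)`. -/
instance : SMul Aᵐᵒᵖ (EllTwo A) where
  smul b a := ⟨fun i => a i * unop b, by
    change Summable fun i => star (a i * unop b) * (a i * unop b)
    refine (((summable_self a).mul_left (star (unop b))).mul_right (unop b)).congr fun i => ?_
    simp [mul_assoc]⟩

@[simp] theorem rsmul_apply (a : EllTwo A) (b : A) (i : ℕ) : (a <• b) i = a i * b := rfl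

/-- The Hilbert module norm `‖a‖ = ‖∑ aᵢ⋆ aᵢ‖^(1/2)`. -/
instance : Norm (EllTwo A) where
  norm a := √‖∑' i, star (a i) * a i‖

/-- The inner product `⟨a, b⟩ = ∑ aᵢ⋆ bᵢ`. -/
instance : CStarModule Aᵐᵒᵖ (EllTwo A) where
  inner a b := op (∑' i, star (a i) * b i)
  inner_add_right {x y z} := by
    simp only [add_apply, mul_add, ← op_add]
    rw [(summable_inner x y).tsum_add (summable_inner x z)]
  inner_self_nonneg {x} :=
    (tsum_nonneg fun i => star_mul_self_nonneg (x i) : 0 ≤ ∑' i, star (x i) * x i)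
  inner_self {x} := by
    constructor
    · intro h
      have h0 : ∑' i, star (x i) * x i = 0 := by simpa using h
      ext i
      have h1 : star (x i) * x i ≤ 0 := h0 ▸
        (summable_self x).le_tsum i fun j _ => star_mul_self_nonneg (x j)
      simpa using le_antisymm h1 (star_mul_self_nonneg (x i))
    · rintro rfl
      simp
  inner_op_smul_right {a x y} := by
    induction a using MulOpposite.rec' with | _ a =>
    rw [← op_mul]
    simp only [rsmul_apply, ← mul_assoc]
    rw [(summable_inner x y).tsum_mul_right]
  inner_smul_right_complex {z x y} := by
    simp only [smul_apply, mul_smul_comm, ← op_smul]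
    rw [(summable_inner x y).tsum_const_smul]
  star_inner x y := by
    rw [← op_star, tsum_star]
    simp
  norm_eq_sqrt_norm_inner_self x := rfl

instance : NormedAddCommGroup (EllTwo A) :=
  NormedAddCommGroup.ofCore (CStarModule.normedSpaceCore Aᵐᵒᵖ)

instance : NormedSpace ℂ (EllTwo A) := NormedSpace.ofCore (CStarModule.normedSpaceCore Aᵐᵒᵖ)

theorem rinner_def (a b : EllTwo A) : rinner A a b = ∑' i, star (a i) * b i := rfl


theorem norm_sq_eq (a : EllTwo A) : ‖a‖ ^ 2 = ‖∑' i, star (a i) * a i‖ :=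
  norm_sq_eq_rinner (A := A) a

theorem norm_apply_le (a : EllTwo A) (k : ℕ) : ‖a k‖ ≤ ‖a‖ := by
  rw [← sq_le_sq₀ (norm_nonneg _) (norm_nonneg _), norm_sq_eq, pow_two,
    ← CStarRing.norm_star_mul_self]
  exact CStarAlgebra.norm_le_norm_of_nonneg_of_le (star_mul_self_nonneg _)
    ((summable_self a).le_tsum k fun j _ => star_mul_self_nonneg (a j))

/-- The coordinate projection `π_k : ℓ²(A) → A`, `a ↦ a_k`. -/
def proj (k : ℕ) : Operator A (EllTwo A) A where
  toContinuousLinearMap := LinearMap.mkContinuous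
    { toFun := fun a => a k
      map_add' := fun _ _ => rfl
      map_smul' := fun _ _ => rfl } 1 fun a => (norm_apply_le a k).trans_eq (one_mul _).symm
  map_rsmul' _ _ := rfl

@[simp] theorem proj_apply (k : ℕ) (a : EllTwo A) : proj k a = a k := rfl

/-- The sequence with `a` in position `i` and zeros elsewhere. -/
def single (i : ℕ) (a : A) : EllTwo A :=
  ⟨Pi.single i a, summable_of_ne_finset_zero (s := {i}) fun j hj => by
    rw [Pi.single_eq_of_ne (by simpa using hj)]
    simp⟩

theorem single_apply (i : ℕ) (a : A) (j : ℕ) :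
    single i a j = (Pi.single i a : ℕ → A) j := rfl

theorem rinner_single_left (i : ℕ) (a : A) (y : EllTwo A) :
    rinner A (single i a) y = star a * y i := by
  rw [rinner_def, tsum_eq_single i fun j hj => by simp [single_apply, Pi.single_eq_of_ne hj]]
  simp [single_apply]

theorem norm_single (i : ℕ) (a : A) : ‖single i a‖ = ‖a‖ := by
  rw [← sq_eq_sq₀ (norm_nonneg _) (norm_nonneg _), norm_sq_eq_rinner (A := A),
    rinner_single_left, single_apply, Pi.single_eq_same, CStarRing.norm_star_mul_self, pow_two]

/-- The coordinate inclusion `A → ℓ²(A)`, `a ↦ (0, …, 0, a, 0, …)` with `a` in position `i`. -/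
def incl (i : ℕ) : Operator A A (EllTwo A) where
  toContinuousLinearMap := LinearMap.mkContinuous
    { toFun := fun a => single i a
      map_add' := fun a b => Subtype.ext (Pi.single_add (f := fun _ => A) i a b)
      map_smul' := fun c a => Subtype.ext (Pi.single_smul (f := fun _ => A) i c a) } 1
      fun a => ((norm_single i a).trans (one_mul _).symm).le
  map_rsmul' x a := by
    ext j
    change (Pi.single i (x * a) : ℕ → A) j = (Pi.single i x : ℕ → A) j * a
    by_cases h : j = i
    · subst h; simp
    · simp [Pi.single_eq_of_ne h]

theorem incl_apply (i : ℕ) (a : A) : incl i a = single i a := rfl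

theorem isAdjointable_incl (i : ℕ) : IsAdjointable (incl (A := A) i) :=
  ⟨proj i, fun a y => rinner_single_left i a y⟩

theorem norm_sum_le_norm_sq (a : EllTwo A) (s : Finset ℕ) :
    ‖∑ i ∈ s, star (a i) * a i‖ ≤ ‖a‖ ^ 2 := by
  rw [norm_sq_eq]
  exact CStarAlgebra.norm_le_norm_of_nonneg_of_le
    (Finset.sum_nonneg fun i _ => star_mul_self_nonneg (a i))
    ((summable_self a).sum_le_tsum s fun j _ => star_mul_self_nonneg (a j))

instance : CompleteSpace (EllTwo A) := by
  refine Metric.complete_of_cauchySeq_tendsto fun u hu => ?_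
  have hk : ∀ k, ∃ b : A, Filter.Tendsto (fun n => u n k) Filter.atTop (nhds b) := fun k =>
    cauchySeq_tendsto_of_complete (hu.map (proj k).toContinuousLinearMap.uniformContinuous)
  choose b hb using hk
  have key : ∀ ε > 0, ∃ N, ∀ n ≥ N, ∀ s : Finset ℕ,
      ‖∑ i ∈ s, star (u n i - b i) * (u n i - b i)‖ ≤ ε ^ 2 := by
    intro ε hε
    obtain ⟨N, hN⟩ := Metric.cauchySeq_iff.1 hu ε hε
    refine ⟨N, fun n hn s => ?_⟩
    have ht : Filter.Tendsto
        (fun m => ‖∑ i ∈ s, star (u n i - u m i) * (u n i - u m i)‖) Filter.atTop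
        (nhds ‖∑ i ∈ s, star (u n i - b i) * (u n i - b i)‖) :=
      (tendsto_finsetSum s fun i _ =>
        ((tendsto_const_nhds.sub (hb i)).star.mul (tendsto_const_nhds.sub (hb i)))).norm
    refine le_of_tendsto ht (Filter.eventually_atTop.2 ⟨N, fun m hm => ?_⟩)
    refine (norm_sum_le_norm_sq (u n - u m) s).trans ?_
    gcongr
    rw [← dist_eq_norm]
    exact (hN n hn m hm).le
  have hmem : b ∈ squareSummable A := by
    refine summable_iff_vanishing_norm.2 fun ε hε => ?_
    obtain ⟨N, hN⟩ := key (√(ε / 8)) (by positivity)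
    have hN := hN N le_rfl
    rw [Real.sq_sqrt (by positivity)] at hN
    obtain ⟨s, hs⟩ := summable_iff_vanishing_norm.1 (summable_self (u N)) (ε / 4) (by positivity)
    refine ⟨s, fun t ht => ?_⟩
    have h1 : ‖∑ i ∈ t, star (b i) * b i‖ ≤ ‖∑ i ∈ t, 2 • (star (u N i) * u N i +
        star (u N i - b i) * (u N i - b i))‖ := by
      refine CStarAlgebra.norm_le_norm_of_nonneg_of_le
        (Finset.sum_nonneg fun i _ => star_mul_self_nonneg (b i)) (Finset.sum_le_sum fun i _ => ?_)
      have := star_add_mul_self_le (u N i) (-(u N i - b i))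
      rwa [star_neg, neg_mul_neg, ← sub_eq_add_neg, sub_sub_cancel] at this
    rw [← Finset.smul_sum, Finset.sum_add_distrib, two_nsmul] at h1
    have h2 := norm_add_le (∑ i ∈ t, star (u N i) * u N i)
      (∑ i ∈ t, star (u N i - b i) * (u N i - b i))
    have h3 := h1.trans (norm_add_le _ _)
    linarith [hs t ht, hN t]
  let c : EllTwo A := ⟨b, hmem⟩
  have hc : ∀ i, c i = b i := fun i => rfl
  refine ⟨c, Metric.tendsto_atTop.2 fun ε hε => ?_⟩
  obtain ⟨M, hM⟩ := key (ε / 2) (half_pos hε)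
  refine ⟨M, fun n hn => lt_of_le_of_lt ?_ (half_lt_self hε)⟩
  rw [dist_eq_norm, ← sq_le_sq₀ (norm_nonneg _) (half_pos hε).le, norm_sq_eq]
  have hs := (summable_self (u n - c)).hasSum.norm
  refine le_of_tendsto hs (Filter.Eventually.of_forall fun s => ?_)
  simpa [hc] using hM n hn s

end EllTwo

end StandardModule

/-! ### The multiplier module -/

section Multiplier

variable {A : Type u} [NonUnitalCStarAlgebra A] [PartialOrder A] [StarOrderedRing A]
variable {E : Type v} [NormedAddCommGroup E] [NormedSpace ℂ E] [SMul Aᵐᵒᵖ E] [CStarModule Aᵐᵒᵖ E]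

instance (A : Type u) [NonUnitalCStarAlgebra A] : PartialOrder 𝓜(ℂ, A) :=
  CStarAlgebra.spectralOrder _

instance (A : Type u) [NonUnitalCStarAlgebra A] : StarOrderedRing 𝓜(ℂ, A) :=
  CStarAlgebra.spectralOrderedRing _

theorem exists_isAdjointable_iff (T : A →L[ℂ] E) :
    (∃ γ : Operator A A E, γ.toContinuousLinearMap = T ∧ IsAdjointable γ) ↔
      ∃ S : E →L[ℂ] A, ∀ (a : A) (y : E), rinner A (T a) y = rinner A a (S y) := by
  constructor
  · rintro ⟨γ, rfl, S, hS⟩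
    exact ⟨S.toContinuousLinearMap, hS⟩
  · rintro ⟨S, hS⟩
    exact ⟨⟨T, rsmul_of_adjoint fun y a => adjoint_symm hS y a⟩, rfl, ⟨S, rsmul_of_adjoint hS⟩, hS⟩

variable (A E) in
/-- The maps `A → E` underlying an adjointable operator. -/
def adjointableMaps : Submodule ℂ (A →L[ℂ] E) where
  carrier := {T | ∃ γ : Operator A A E, γ.toContinuousLinearMap = T ∧ IsAdjointable γ}
  add_mem' {T U} hT hU := by
    obtain ⟨S, hS⟩ := (exists_isAdjointable_iff T).1 hT
    obtain ⟨R, hR⟩ := (exists_isAdjointable_iff U).1 hU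
    exact (exists_isAdjointable_iff _).2 ⟨S + R, fun a y => by
      simp only [_root_.add_apply, rinner_add_left, rinner_add_right, hS, hR]⟩
  zero_mem' := (exists_isAdjointable_iff _).2 ⟨0, fun a y => by simp [rinner]⟩
  smul_mem' c T hT := by
    obtain ⟨S, hS⟩ := (exists_isAdjointable_iff T).1 hT
    refine (exists_isAdjointable_iff _).2 ⟨star c • S, fun a y => ?_⟩
    rw [_root_.smul_apply, _root_.smul_apply, rinner_smul_right, ← hS,
      ← star_rinner, rinner_smul_right, star_smul, star_rinner]

variable (A E) in
/-- The multiplier module `M(E)` of `E`: all adjointable maps from `A` to `E`, with the operator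
norm. -/
def MultiplierModule : Type (max u v) := adjointableMaps A E

namespace MultiplierModule

instance : NormedAddCommGroup (MultiplierModule A E) :=
  inferInstanceAs (NormedAddCommGroup (adjointableMaps A E))

instance : NormedSpace ℂ (MultiplierModule A E) :=
  inferInstanceAs (NormedSpace ℂ (adjointableMaps A E))

/-- The underlying bounded map `A → E`. -/
def toMap (r : MultiplierModule A E) : A →L[ℂ] E := r.1

theorem toMap_injective : Function.Injective (toMap : MultiplierModule A E → (A →L[ℂ] E)) :=
  Subtype.val_injective

theorem exists_adj (r : MultiplierModule A E) :
    ∃ S : E →L[ℂ] A, ∀ (a : A) (y : E), rinner A (r.toMap a) y = rinner A a (S y) :=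
  (exists_isAdjointable_iff r.toMap).1 r.2

/-- The adjoint `r⋆ : E → A` of `r`. -/
def adj (r : MultiplierModule A E) : E →L[ℂ] A := r.exists_adj.choose

theorem rinner_toMap (r : MultiplierModule A E) (a : A) (y : E) :
    rinner A (r.toMap a) y = star a * r.adj y := r.exists_adj.choose_spec a y

theorem star_adj_mul (r : MultiplierModule A E) (y : E) (a : A) :
    star (r.adj y) * a = rinner A y (r.toMap a) := by
  rw [← star_rinner, rinner_toMap, star_mul, star_star]

theorem norm_adj_apply_le (r : MultiplierModule A E) (y : E) : ‖r.adj y‖ ≤ ‖r‖ * ‖y‖ := by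
  rcases eq_or_lt_of_le (norm_nonneg (r.adj y)) with h | h
  · rw [← h]; positivity
  · refine le_of_mul_le_mul_left ?_ h
    rw [← CStarRing.norm_star_mul_self, ← rinner_toMap]
    refine (norm_rinner_le _ _).trans ?_
    calc ‖r.toMap (r.adj y)‖ * ‖y‖ ≤ (‖r‖ * ‖r.adj y‖) * ‖y‖ := by
          gcongr; exact r.toMap.le_opNorm _
      _ = _ := by ring

/-- The `M(A)`-valued inner product `⟨r₁, r₂⟩ = r₁⋆ r₂`, as a double centralizer of `A`: its left
action is `r₁⋆ ∘ r₂`. -/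
def innerM (r₁ r₂ : MultiplierModule A E) : 𝓜(ℂ, A) where
  fst := r₁.adj.comp r₂.toMap
  snd :=
    { toFun := fun x => star (r₂.adj (r₁.toMap (star x)))
      map_add' := fun x y => by simp
      map_smul' := fun c x => by simp
      cont := by fun_prop }
  central x y := by
    change star (r₂.adj (r₁.toMap (star x))) * y = x * r₁.adj (r₂.toMap y)
    rw [star_adj_mul, rinner_toMap, star_star]

theorem innerM_fst (r₁ r₂ : MultiplierModule A E) (a : A) :
    (innerM r₁ r₂).fst a = r₁.adj (r₂.toMap a) := rfl

theorem innerM_snd (r₁ r₂ : MultiplierModule A E) (a : A) :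
    (innerM r₁ r₂).snd a = star (r₂.adj (r₁.toMap (star a))) := rfl

theorem multiplier_ext {S T : 𝓜(ℂ, A)} (h : ∀ a b : A, star a * S.fst b = star a * T.fst b) :
    S = T := by
  rw [← sub_eq_zero, ← norm_eq_zero, ← DoubleCentralizer.norm_fst, norm_eq_zero]
  ext b
  rw [DoubleCentralizer.sub_fst, _root_.sub_apply, _root_.zero_apply,
    sub_eq_zero]
  exact ext_rinner_right (A := A) fun z => h z b

theorem star_mul_innerM (r₁ r₂ : MultiplierModule A E) (a b : A) :
    star a * (innerM r₁ r₂).fst b = rinner A (r₁.toMap a) (r₂.toMap b) := by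
  rw [innerM_fst, rinner_toMap]

theorem star_innerM (r₁ r₂ : MultiplierModule A E) : star (innerM r₁ r₂) = innerM r₂ r₁ := by
  refine multiplier_ext fun a b => ?_
  rw [DoubleCentralizer.star_fst, innerM_snd, star_star, star_star, innerM_fst]

theorem multiplier_nonneg {T : 𝓜(ℂ, A)} (hT : IsSelfAdjoint T)
    (h : ∀ a : A, 0 ≤ star a * T.fst a) : 0 ≤ T := by
  rw [← CFC.negPart_eq_zero_iff T hT]
  set c : 𝓜(ℂ, A) := T⁻ with hc
  have hc0 : 0 ≤ c := CFC.negPart_nonneg T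
  have hcs : star c = c := (IsSelfAdjoint.of_nonneg hc0)
  obtain ⟨s, hs⟩ := CStarAlgebra.nonneg_iff_eq_star_mul_self.1 hc0
  have hcT : c * T = -(c * c) := by
    conv_lhs => rw [← CFC.posPart_sub_negPart T hT]
    rw [mul_sub, CFC.negPart_mul_posPart, zero_sub]
  have hst : ∀ (R : 𝓜(ℂ, A)) (x y : A), star (R.fst x) * y = star x * (star R).fst y := by
    intro R x y
    have := (star R).central (star x) y
    rwa [DoubleCentralizer.star_snd, star_star] at this
  have hsc : s * c = 0 := by
    refine multiplier_ext fun a b => ?_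
    have h1 := h (c.fst b)
    have h2 : star (c.fst b) * T.fst (c.fst b) =
        -(star ((s * c).fst b) * (s * c).fst b) := by
      rw [hst, hst, hcs]
      change star b * (c * T * c).fst b = -(star b * (star (s * c) * (s * c)).fst b)
      rw [hcT, star_mul, hcs]
      have : c * star s * (s * c) = c * c * c := by rw [hs]; simp only [mul_assoc]
      rw [this]
      simp
    rw [h2, Left.nonneg_neg_iff] at h1
    have h3 := le_antisymm h1 (star_mul_self_nonneg _)
    rw [CStarRing.star_mul_self_eq_zero_iff] at h3
    rw [h3]; simp
  have hcc : c * c = 0 := by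
    nth_rewrite 1 [hs]
    rw [mul_assoc, hsc, mul_zero]
  rw [← CStarRing.star_mul_self_eq_zero_iff, hcs, hcc]

/-- The right action of `M(A)` on `M(E)` by composition, `(r <• m)(a) = r (m a)`. -/
instance : SMul 𝓜(ℂ, A)ᵐᵒᵖ (MultiplierModule A E) where
  smul m r := ⟨r.toMap.comp (unop m).fst, by
    refine (exists_isAdjointable_iff _).2 ⟨(star (unop m)).fst.comp r.adj, fun a y => ?_⟩
    change rinner A (r.toMap ((unop m).fst a)) y = star a * (star (unop m)).fst (r.adj y)
    have := (star (unop m)).central (star a) (r.adj y)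
    rw [DoubleCentralizer.star_snd, star_star] at this
    rw [rinner_toMap, this]⟩

@[simp] theorem toMap_rsmul (r : MultiplierModule A E) (m : 𝓜(ℂ, A)) (a : A) :
    (r <• m).toMap a = r.toMap (m.fst a) := rfl

theorem toMap_add (r s : MultiplierModule A E) (a : A) :
    (r + s).toMap a = r.toMap a + s.toMap a := rfl

theorem toMap_smul (c : ℂ) (r : MultiplierModule A E) (a : A) :
    (c • r).toMap a = c • r.toMap a := rfl

theorem norm_eq_sqrt (r : MultiplierModule A E) : ‖r‖ = √‖innerM r r‖ := by
  apply le_antisymm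
  · refine r.toMap.opNorm_le_bound (Real.sqrt_nonneg _) fun a => ?_
    rw [← sq_le_sq₀ (norm_nonneg _) (by positivity), mul_pow, Real.sq_sqrt (norm_nonneg _),
      norm_sq_eq_rinner (A := A), rinner_toMap, ← innerM_fst]
    calc ‖star a * (innerM r r).fst a‖ ≤ ‖star a‖ * ‖(innerM r r).fst a‖ := norm_mul_le _ _
      _ ≤ ‖a‖ * (‖innerM r r‖ * ‖a‖) := by
          rw [norm_star, ← DoubleCentralizer.norm_fst]
          gcongr; exact ContinuousLinearMap.le_opNorm _ _
      _ = _ := by ring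
  · rw [Real.sqrt_le_left (norm_nonneg _), ← DoubleCentralizer.norm_fst]
    refine ContinuousLinearMap.opNorm_le_bound _ (by positivity) fun a => ?_
    calc ‖r.adj (r.toMap a)‖ ≤ ‖r‖ * ‖r.toMap a‖ := r.norm_adj_apply_le _
      _ ≤ ‖r‖ * (‖r‖ * ‖a‖) := by gcongr; exact r.toMap.le_opNorm a
      _ = _ := by ring

/-- `M(E)` is a right Hilbert module over `M(A)`. -/
instance : CStarModule 𝓜(ℂ, A)ᵐᵒᵖ (MultiplierModule A E) where
  inner r₁ r₂ := op (innerM r₁ r₂)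
  inner_add_right {x y z} := by
    rw [← op_add]
    refine congrArg op (multiplier_ext fun a b => ?_)
    simp only [DoubleCentralizer.add_fst, _root_.add_apply, innerM_fst, toMap_add,
      map_add]
  inner_self_nonneg {x} := by
    change 0 ≤ innerM x x
    refine multiplier_nonneg (star_innerM x x) fun a => ?_
    rw [star_mul_innerM]
    exact rinner_self_nonneg _
  inner_self {x} := by
    rw [op_eq_zero_iff]
    constructor
    · intro h
      refine toMap_injective (ContinuousLinearMap.ext fun a => ?_)
      change x.toMap a = 0
      rw [← rinner_self_eq_zero (A := A), ← star_mul_innerM, h]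
      simp
    · rintro rfl
      refine multiplier_ext fun a b => ?_
      rw [innerM_fst]
      change star a * adj 0 ((0 : A →L[ℂ] E) b) = _
      simp
  inner_op_smul_right {a x y} := by
    induction a using MulOpposite.rec' with | _ m =>
    rw [← op_mul]
    exact congrArg op (multiplier_ext fun a b => rfl)
  inner_smul_right_complex {z x y} := by
    rw [← op_smul]
    refine congrArg op (multiplier_ext fun a b => ?_)
    simp only [DoubleCentralizer.smul_fst, _root_.smul_apply, innerM_fst, toMap_smul,
      map_smul]
  star_inner x y := by rw [← op_star, star_innerM]
  norm_eq_sqrt_norm_inner_self x := by rw [norm_op]; exact norm_eq_sqrt x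

theorem rinner_def (r₁ r₂ : MultiplierModule A E) : rinner 𝓜(ℂ, A) r₁ r₂ = innerM r₁ r₂ := rfl

theorem adj_sub (r s : MultiplierModule A E) : (r - s).adj = r.adj - s.adj := by
  ext y
  refine ext_rinner_right (A := A) fun a => ?_
  rw [_root_.sub_apply, rinner_sub_right]
  simp only [rinner_self_def, ← rinner_toMap, ← rinner_sub_left]
  rfl

instance [CompleteSpace E] : CompleteSpace (MultiplierModule A E) := by
  refine Metric.complete_of_cauchySeq_tendsto fun u hu => ?_
  have hlip : LipschitzWith 1 (adj : MultiplierModule A E → (E →L[ℂ] A)) := by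
    refine LipschitzWith.of_dist_le_mul fun r s => ?_
    rw [dist_eq_norm, dist_eq_norm, ← adj_sub, NNReal.coe_one, one_mul]
    exact ContinuousLinearMap.opNorm_le_bound _ (norm_nonneg _) (norm_adj_apply_le _)
  have hlip' : LipschitzWith 1 (toMap : MultiplierModule A E → (A →L[ℂ] E)) :=
    LipschitzWith.of_dist_le_mul fun r s => by rw [NNReal.coe_one, one_mul]; rfl
  obtain ⟨T, hT⟩ := cauchySeq_tendsto_of_complete (hlip'.uniformContinuous.comp_cauchySeq hu)
  obtain ⟨S, hS⟩ := cauchySeq_tendsto_of_complete (hlip.uniformContinuous.comp_cauchySeq hu)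
  have hmem : T ∈ adjointableMaps A E := (exists_isAdjointable_iff T).2 ⟨S, fun a y => by
    have h1 : Filter.Tendsto (fun n => (u n).toMap a) Filter.atTop (nhds (T a)) :=
      ((ContinuousLinearMap.apply ℂ E a).continuous.tendsto T).comp hT
    have h2 : Filter.Tendsto (fun n => (u n).adj y) Filter.atTop (nhds (S y)) :=
      ((ContinuousLinearMap.apply ℂ A y).continuous.tendsto S).comp hS
    have h3 := (continuous_rinner (A := A)).tendsto (T a, y) |>.comp
      (h1.prodMk_nhds (tendsto_const_nhds (x := y)))
    have h4 := h2.const_mul (star a)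
    refine tendsto_nhds_unique h3 (h4.congr fun n => ?_)
    exact ((u n).rinner_toMap a y).symm⟩
  let r : MultiplierModule A E := ⟨T, hmem⟩
  have h0 : Filter.Tendsto (fun n => dist ((u n).toMap) T) Filter.atTop (nhds 0) :=
    tendsto_iff_dist_tendsto_zero.1 hT
  exact ⟨r, tendsto_iff_dist_tendsto_zero.2 h0⟩

/-- An adjointable operator `A → E` as an element of `M(E)`. -/
def ofOperator (γ : Operator A A E) (hγ : IsAdjointable γ) : MultiplierModule A E :=
  ⟨γ.toContinuousLinearMap, γ, rfl, hγ⟩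

end MultiplierModule

end Multiplier

/-! ### Matrix rows and the dual of `M(ℓ²(A))` -/

section Rows

variable {A : Type u} [NonUnitalCStarAlgebra A] [PartialOrder A] [StarOrderedRing A]

/-- The `k`-th row of the matrix of `F : ℓ²(A) → ℓ²(A)`: its `i`-th entry is the bounded
`A`-morphism (left multiplier) `π_k ∘ F ∘ ι_i : A → A`. -/
def matrixRow (F : Operator A (EllTwo A) (EllTwo A)) (k : ℕ) : ℕ → Operator A A A :=
  fun i => ((EllTwo.proj k).comp F).comp (EllTwo.incl i)

variable (A) in
/-- The dual module `M(ℓ²(A))'`: all bounded `M(A)`-morphisms `M(ℓ²(A)) → M(A)`. -/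
abbrev MultiplierDual : Type u :=
  Operator 𝓜(ℂ, A) (MultiplierModule A (EllTwo A)) 𝓜(ℂ, A)

/-- Left multiplication `a ↦ m a` of `A` by `m ∈ M(A)`. -/
def leftMul (m : 𝓜(ℂ, A)) : Operator A A A where
  toContinuousLinearMap := m.fst
  map_rsmul' x a := by
    refine ext_rinner_right (A := A) fun z => ?_
    change star z * m.fst (x * a) = star z * (m.fst x * a)
    rw [← m.central, ← mul_assoc, m.central, mul_assoc]

/-- The coefficient sequence of `φ ∈ M(ℓ²(A))'`: its `i`-th term is the left multiplication
operator of `φ(e_i) ∈ M(A)`, where `e_i ∈ M(ℓ²(A))` is the `i`-th coordinate inclusion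
`A → ℓ²(A)`. -/
def dualCoeff (φ : MultiplierDual A) : ℕ → Operator A A A :=
  fun i => leftMul (φ (.ofOperator (EllTwo.incl i) (EllTwo.isAdjointable_incl i)))

/-- A sequence of left multipliers belongs to `M(ℓ²(A))'` if it is the coefficient sequence of
some element of `M(ℓ²(A))'`. -/
def BelongsToMultiplierDual (r : ℕ → Operator A A A) : Prop :=
  ∃ φ : MultiplierDual A, dualCoeff φ = r

end Rows

end HilbertModule

end

noncomputable section

set_option linter.unusedSectionVars false

namespace HilbertModule

open MultiplierModule

universe u v w

section

variable {A : Type u} [NonUnitalCStarAlgebra A] [PartialOrder A] [StarOrderedRing A]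
variable {E : Type v} [NormedAddCommGroup E] [NormedSpace ℂ E] [SMul Aᵐᵒᵖ E] [CStarModule Aᵐᵒᵖ E]
variable {F : Type w} [NormedAddCommGroup F] [NormedSpace ℂ F] [SMul Aᵐᵒᵖ F] [CStarModule Aᵐᵒᵖ F]
variable {G : Type*} [NormedAddCommGroup G] [NormedSpace ℂ G] [SMul Aᵐᵒᵖ G] [CStarModule Aᵐᵒᵖ G]

/-! For 1), the projections are adjointable, so one direction is composition. Conversely, let `T = F
∘ γ : A → ℓ²(A)` have coordinates with adjoints `t i`. The only possible adjoint is `y ↦ ∑ t i (y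
i)`, and boundedness of `T` makes this series converge: a finite partial sum `z` over `s` satisfies
`z⋆ z = ⟨T z, y_s⟩`, where `y_s` is `y` cut down to `s`, so `‖z‖ ≤ ‖T‖ ‖y_s‖`, and `y` is the norm
limit of its truncations (`isAdjointable_of_proj`, `hasSum_single`).

For 2), by 1) it suffices to treat one row `T = π_k ∘ F : ℓ²(A) → A`. If `T` is locally adjointable,
then `r ↦ T ∘ r` is the required functional on `M(ℓ²(A))`. Conversely, let `φ` have the coefficients
of `T`. Finitely supported elements need not be dense in `M(ℓ²(A))`, so `φ(γ)` cannot be compared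
with `T ∘ γ` directly. They are dense in `ℓ²(A)`, which maps continuously into `M(ℓ²(A))` by `x ↦ (b
↦ x b)`; hence `φ` is left multiplication by `T x` at the image of `x`. Since `γ · a` is the image
of `γ a`, it follows that `φ(γ) a = T (γ a)`, so `T ∘ γ` is left multiplication by a multiplier,
hence adjointable (`comp_eq_leftMul_of_dualCoeff`). -/

/-! ### Criteria for adjointability -/

theorem Operator.ext_apply {S T : Operator A E F} (h : ∀ x, S x = T x) : S = T := by
  cases S
  cases T
  congr 1
  exact ContinuousLinearMap.ext h

theorem IsAdjointable.comp {S : Operator A F G} {T : Operator A E F} (hS : IsAdjointable S)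
    (hT : IsAdjointable T) : IsAdjointable (S.comp T) := by
  obtain ⟨S', hS'⟩ := hS
  obtain ⟨T', hT'⟩ := hT
  exact ⟨T'.comp S', fun x y => (hS' (T x) y).trans (hT' x (S' y))⟩

/-- Adjointability of `T : A → E` can be checked pointwise on `E`. -/
theorem isAdjointable_of_forall_exists (T : Operator A A E)
    (h : ∀ y : E, ∃ z : A, ∀ a : A, rinner A (T a) y = star a * z) : IsAdjointable T := by
  choose S hS using h
  -- An element of `A` is determined by its left multiples, so `S y` is unique and linearity of `S`
  -- is automatic.
  have hlin : ∀ {x y : A}, (∀ a : A, star a * x = star a * y) → x = y := fun h =>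
    ext_rinner_right (A := A) h
  let L : E →ₗ[ℂ] A :=
    { toFun := S
      map_add' := fun x y => hlin fun a => by
        rw [← hS, rinner_add_right, hS, hS, mul_add]
      map_smul' := fun c x => hlin fun a => by
        rw [← hS, rinner_smul_right, hS, RingHom.id_apply, mul_smul_comm] }
  have hb : ∀ y, ‖L y‖ ≤ ‖T.toContinuousLinearMap‖ * ‖y‖ := fun y => by
    change ‖S y‖ ≤ _
    rcases eq_or_lt_of_le (norm_nonneg (S y)) with h | h
    · rw [← h]; positivity
    · refine le_of_mul_le_mul_left ?_ h
      -- Taking `a = S y` in `hS` gives `(S y)⋆ S y = ⟨T (S y), y⟩`; Cauchy–Schwarz then bounds `‖S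
      -- y‖²`.
      rw [← CStarRing.norm_star_mul_self, ← hS]
      refine (norm_rinner_le _ _).trans ?_
      calc ‖T (S y)‖ * ‖y‖ ≤ (‖T.toContinuousLinearMap‖ * ‖S y‖) * ‖y‖ := by
            gcongr; exact T.toContinuousLinearMap.le_opNorm _
        _ = _ := by ring
  obtain ⟨γ, hγ, hadj⟩ := (exists_isAdjointable_iff T.toContinuousLinearMap).2
    ⟨L.mkContinuous _ hb, fun a y => hS y a⟩
  rwa [← Operator.ext_apply (S := γ) (T := T) fun x => by rw [hγ]]

/-! ### The canonical map from `E` to `M(E)` -/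

theorem norm_rsmul_le (x : E) (b : A) : ‖x <• b‖ ≤ ‖x‖ * ‖b‖ := by
  rw [← sq_le_sq₀ (norm_nonneg _) (by positivity), norm_sq_eq_rinner (A := A),
    rinner_rsmul_right, ← star_rinner, rinner_rsmul_right, star_mul, star_rinner, mul_pow,
    norm_sq_eq_rinner (A := A) x]
  calc ‖star b * rinner A x x * b‖ ≤ ‖star b‖ * ‖rinner A x x‖ * ‖b‖ :=
        (norm_mul_le _ _).trans (by gcongr; exact norm_mul_le _ _)
    _ = _ := by rw [norm_star]; ring

theorem rinner_rsmul_left (x y : E) (b : A) :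
    rinner A (x <• b) y = star b * rinner A x y := by
  rw [← star_rinner, rinner_rsmul_right, star_mul, star_rinner]

/-- A map `A → E` underlying an adjointable operator, as an element of `M(E)`. -/
def ofMap (T : A →L[ℂ] E) (hT : T ∈ adjointableMaps A E) : MultiplierModule A E := ⟨T, hT⟩

theorem toMap_ofMap (T : A →L[ℂ] E) (hT : T ∈ adjointableMaps A E) : (ofMap T hT).toMap = T := rfl

theorem norm_toMap (r : MultiplierModule A E) : ‖r.toMap‖ = ‖r‖ := rfl

/-- The bounded map `b ↦ x b` from `A` to `E`. -/
def orbitMap (x : E) : A →L[ℂ] E :=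
  LinearMap.mkContinuous
    { toFun := fun b => x <• b
      -- The action on `E` is only assumed to be an `SMul`; its linearity is read off from inner
      -- products.
      map_add' := fun b c => ext_rinner_left (A := A) fun z => by
        simp only [rinner_rsmul_left, rinner_add_left, star_add, add_mul]
      map_smul' := fun c b => ext_rinner_right (A := A) fun z => by
        simp only [rinner_rsmul_right, rinner_smul_right, mul_smul_comm, RingHom.id_apply] }
    ‖x‖ (norm_rsmul_le x)

theorem orbitMap_apply (x : E) (b : A) : orbitMap x b = x <• b := rfl

theorem norm_orbitMap_le (x : E) : ‖(orbitMap x : A →L[ℂ] E)‖ ≤ ‖x‖ :=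
  LinearMap.mkContinuous_norm_le _ (norm_nonneg x) _

/-- The adjoint of `b ↦ x b` is `y ↦ ⟨x, y⟩`, bounded by Cauchy–Schwarz. -/
theorem orbitMap_mem_adjointableMaps (x : E) : orbitMap x ∈ adjointableMaps A E :=
  (exists_isAdjointable_iff _).2
    ⟨LinearMap.mkContinuous
      { toFun := fun y => rinner A x y
        map_add' := rinner_add_right x
        map_smul' := fun c y => rinner_smul_right c x y } ‖x‖ (norm_rinner_le x),
      fun b y => rinner_rsmul_left x y b⟩

/-- The map `b ↦ x b` as an element of `M(E)`, depending linearly and continuously on `x`. -/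
def toMultiplierModule : E →L[ℂ] MultiplierModule A E :=
  LinearMap.mkContinuous
    { toFun := fun x => ofMap (orbitMap x) (orbitMap_mem_adjointableMaps x)
      map_add' := fun x y => toMap_injective (ContinuousLinearMap.ext fun b =>
        ext_rinner_right (A := A) fun z => by
          simp only [toMap_add, toMap_ofMap, orbitMap_apply, rinner_rsmul_right,
            rinner_add_right, add_mul])
      map_smul' := fun c x => toMap_injective (ContinuousLinearMap.ext fun b =>
        ext_rinner_right (A := A) fun z => by
          simp only [toMap_smul, toMap_ofMap, orbitMap_apply, rinner_rsmul_right,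
            rinner_smul_right, smul_mul_assoc, RingHom.id_apply]) }
    1 fun x => by
      rw [one_mul]
      exact norm_orbitMap_le x

/-- Because `γ (a b) = γ(a) b`, multiplying by an element of `A` moves any adjointable map into the
image of `E`, the part of `M(E)` that continuity arguments on `E` can reach. -/
theorem ofOperator_rsmul_coe (γ : Operator A A E) (hγ : IsAdjointable γ) (a : A) :
    ofOperator γ hγ <• (a : 𝓜(ℂ, A)) = toMultiplierModule (γ a) :=
  toMap_injective (ContinuousLinearMap.ext fun b => γ.map_rsmul' a b)

/-! ### Multipliers of `A` and composition with locally adjointable maps -/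

theorem isAdjointable_leftMul (m : 𝓜(ℂ, A)) : IsAdjointable (leftMul m) := by
  refine ⟨leftMul (star m), fun x y => ?_⟩
  have := (star m).central (star x) y
  rwa [DoubleCentralizer.star_snd, star_star] at this

variable (A) in
theorem isAdjointable_id : IsAdjointable (⟨.id ℂ A, fun _ _ => rfl⟩ : Operator A A A) :=
  ⟨⟨.id ℂ A, fun _ _ => rfl⟩, fun _ _ => rfl⟩

/-- An adjointable map `A → A`, as a multiplier of `A`. -/
def toMultiplier (r : MultiplierModule A A) : 𝓜(ℂ, A) :=
  -- As `⟨id, r⟩ = id⋆ r = r`, the inner product of `M(A)`-valued type supplies the right half of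
  -- the double centralizer.
  innerM (ofOperator _ (isAdjointable_id A)) r

theorem toMultiplier_fst (r : MultiplierModule A A) : (toMultiplier r).fst = r.toMap := by
  ext b
  refine ext_rinner_right (A := A) fun z => ?_
  exact star_mul_innerM (ofOperator _ (isAdjointable_id A)) r z b

theorem multiplier_ext_fst {S T : 𝓜(ℂ, A)} (h : S.fst = T.fst) : S = T :=
  multiplier_ext fun a b => by rw [h]

theorem IsLocallyAdjointable.comp_mem_adjointableMaps {T : Operator A E F}
    (hT : IsLocallyAdjointable T) (r : MultiplierModule A E) :
    T.toContinuousLinearMap.comp r.toMap ∈ adjointableMaps A F := by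
  obtain ⟨γ, hγ, hadj⟩ := r.2
  exact ⟨T.comp γ, congrArg (T.toContinuousLinearMap.comp ·) hγ, hT γ hadj⟩

/-- Composition with a locally adjointable `T : E → A`, as a map `M(E) → M(A)`. -/
def IsLocallyAdjointable.compMultiplier {T : Operator A E A} (hT : IsLocallyAdjointable T)
    (r : MultiplierModule A E) : 𝓜(ℂ, A) :=
  toMultiplier (ofMap _ (hT.comp_mem_adjointableMaps r))

theorem IsLocallyAdjointable.compMultiplier_fst {T : Operator A E A} (hT : IsLocallyAdjointable T)
    (r : MultiplierModule A E) :
    (hT.compMultiplier r).fst = T.toContinuousLinearMap.comp r.toMap :=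
  toMultiplier_fst _

/-- A locally adjointable `T : E → A` acts by composition as a bounded `M(A)`-morphism
`M(E) → M(A)`. -/
def IsLocallyAdjointable.multiplierMap {T : Operator A E A} (hT : IsLocallyAdjointable T) :
    Operator 𝓜(ℂ, A) (MultiplierModule A E) 𝓜(ℂ, A) where
  toContinuousLinearMap := LinearMap.mkContinuous
    { toFun := hT.compMultiplier
      map_add' := fun r s => multiplier_ext_fst <| by
        rw [DoubleCentralizer.add_fst]
        simp only [hT.compMultiplier_fst]
        exact ContinuousLinearMap.comp_add _ _ _
      map_smul' := fun c r => multiplier_ext_fst <| by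
        rw [RingHom.id_apply, DoubleCentralizer.smul_fst]
        simp only [hT.compMultiplier_fst]
        exact ContinuousLinearMap.comp_smul _ _ _ }
    ‖T.toContinuousLinearMap‖ fun r => by
      change ‖hT.compMultiplier r‖ ≤ _
      rw [← DoubleCentralizer.norm_fst, hT.compMultiplier_fst, ← norm_toMap]
      exact ContinuousLinearMap.opNorm_comp_le _ _
  map_rsmul' r m := multiplier_ext_fst <| by
    change (hT.compMultiplier (r <• m)).fst = (hT.compMultiplier r * m).fst
    rw [DoubleCentralizer.mul_fst, hT.compMultiplier_fst, hT.compMultiplier_fst]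
    rfl

theorem IsLocallyAdjointable.multiplierMap_fst {T : Operator A E A} (hT : IsLocallyAdjointable T)
    (r : MultiplierModule A E) (a : A) : (hT.multiplierMap r).fst a = T (r.toMap a) :=
  congrArg (fun S : A →L[ℂ] A => S a) (hT.compMultiplier_fst r)

end

/-! ### Coordinates and truncations in `ℓ²(A)` -/

namespace EllTwo

variable {A : Type u} [NonUnitalCStarAlgebra A] [PartialOrder A] [StarOrderedRing A]
variable {E : Type v} [NormedAddCommGroup E] [NormedSpace ℂ E] [SMul Aᵐᵒᵖ E] [CStarModule Aᵐᵒᵖ E]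

theorem isAdjointable_proj (k : ℕ) : IsAdjointable (proj (A := A) k) :=
  ⟨incl k, fun x y => by
    rw [incl_apply, ← star_rinner (single k y) x, rinner_single_left, star_mul, star_star]
    rfl⟩

theorem sum_single_apply (x : EllTwo A) (s : Finset ℕ) (j : ℕ) :
    (∑ i ∈ s, single i (x i)) j = if j ∈ s then x j else 0 := by
  change proj j (∑ i ∈ s, single i (x i)) = _
  rw [map_sum]
  simp only [proj_apply, single_apply, Pi.single_apply, Finset.sum_ite_eq]

theorem rinner_sum_single (x : EllTwo A) (s : Finset ℕ) (y : EllTwo A) :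
    rinner A y (∑ i ∈ s, single i (x i)) = ∑ i ∈ s, star (y i) * x i := by
  rw [rinner_def, tsum_eq_sum (s := s) fun j hj => by rw [sum_single_apply, if_neg hj, mul_zero]]
  exact Finset.sum_congr rfl fun i hi => by rw [sum_single_apply, if_pos hi]

theorem norm_sq_sum_single (x : EllTwo A) (s : Finset ℕ) :
    ‖∑ i ∈ s, single i (x i)‖ ^ 2 = ‖∑ i ∈ s, star (x i) * x i‖ := by
  rw [norm_sq_eq_rinner (A := A), rinner_sum_single]
  congr 1
  exact Finset.sum_congr rfl fun i hi => by rw [sum_single_apply, if_pos hi]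

/-- The squared norm of a finite block of `x` is the norm of the corresponding block of `∑ xᵢ⋆ xᵢ`,
so the Cauchy criterion passes from that series to this one. -/
theorem hasSum_single (x : EllTwo A) : HasSum (fun i => single i (x i)) x := by
  have hs : Summable fun i => single i (x i) := by
    rw [summable_iff_vanishing_norm]
    intro ε hε
    obtain ⟨s, hs⟩ := summable_iff_vanishing_norm.1 (summable_self x) (ε ^ 2) (by positivity)
    refine ⟨s, fun t ht => ?_⟩
    rw [← sq_lt_sq₀ (norm_nonneg _) hε.le, norm_sq_sum_single]
    exact hs t ht
  -- Completeness gives some sum; the continuous coordinate projections identify it with `x`.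
  convert hs.hasSum using 1
  ext j
  have h := hs.hasSum.mapL (proj j).toContinuousLinearMap
  refine HasSum.unique ?_ h
  have hsingle : (fun i => proj j (single i (x i))) = fun i => if i = j then x j else 0 := by
    funext i
    change (Pi.single i (x i) : ℕ → A) j = _
    by_cases hij : i = j
    · subst hij; simp
    · simp [hij]
  rw [hsingle]
  exact hasSum_ite_eq j (x j)

/-- Continuous linear maps on `ℓ²(A)` agreeing on the coordinate inclusions are equal. -/
theorem clm_ext_single {V : Type*} [NormedAddCommGroup V] [NormedSpace ℂ V]
    {S T : EllTwo A →L[ℂ] V} (h : ∀ i a, S (single i a) = T (single i a)) : S = T := by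
  ext x
  have hS := (hasSum_single x).mapL S
  have hT := (hasSum_single x).mapL T
  simp only [h] at hS
  exact hS.unique hT

/-! ### Coordinatewise adjointability -/

/-- An operator `A → ℓ²(A)` with adjointable coordinates is adjointable. -/
theorem isAdjointable_of_proj (T : Operator A A (EllTwo A))
    (h : ∀ k, IsAdjointable ((proj k).comp T)) : IsAdjointable T := by
  choose t ht using h
  have ht : ∀ k (a b : A), star (T a k) * b = star a * t k b := ht
  refine isAdjointable_of_forall_exists T fun y => ?_
  have hbound : ∀ s : Finset ℕ, ‖∑ i ∈ s, t i (y i)‖ ≤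
      ‖T.toContinuousLinearMap‖ * ‖∑ i ∈ s, single i (y i)‖ := fun s => by
    set z := ∑ i ∈ s, t i (y i) with hz
    rcases eq_or_lt_of_le (norm_nonneg z) with h | h
    · rw [← h]; positivity
    · refine le_of_mul_le_mul_left ?_ h
      have h1 : star z * z = rinner A (T z) (∑ i ∈ s, single i (y i)) := by
        rw [rinner_sum_single]
        simp only [ht]
        rw [← Finset.mul_sum]
      rw [← CStarRing.norm_star_mul_self, h1]
      refine (norm_rinner_le _ _).trans ?_
      calc ‖T z‖ * ‖∑ i ∈ s, single i (y i)‖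
          ≤ (‖T.toContinuousLinearMap‖ * ‖z‖) * ‖∑ i ∈ s, single i (y i)‖ := by
            gcongr; exact T.toContinuousLinearMap.le_opNorm _
        _ = _ := by ring
  have hs : Summable fun i => t i (y i) := by
    rw [summable_iff_vanishing_norm]
    intro ε hε
    -- The added 1 keeps the divisor positive when `T = 0`.
    have hC : 0 < ‖T.toContinuousLinearMap‖ + 1 := by positivity
    obtain ⟨s, hs⟩ := summable_iff_vanishing_norm.1 (hasSum_single y).summable
      (ε / (‖T.toContinuousLinearMap‖ + 1)) (by positivity)
    refine ⟨s, fun u hu => (hbound u).trans_lt ?_⟩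
    have h1 := hs u hu
    rw [lt_div_iff₀ hC] at h1
    nlinarith [norm_nonneg (∑ i ∈ u, single i (y i))]
  refine ⟨∑' i, t i (y i), fun a => ?_⟩
  rw [rinner_def, ← hs.tsum_mul_left]
  exact tsum_congr fun i => ht i a (y i)

/-- Local adjointability only tests the maps `F ∘ γ`, whose domain is `A`, so
`isAdjointable_of_proj` applies to each of them. -/
theorem isLocallyAdjointable_iff_proj (F : Operator A E (EllTwo A)) :
    IsLocallyAdjointable F ↔ ∀ k, IsLocallyAdjointable ((proj k).comp F) :=
  ⟨fun h k γ hγ => (isAdjointable_proj k).comp (h γ hγ),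
    fun h γ hγ => isAdjointable_of_proj (F.comp γ) fun k => h k γ hγ⟩

/-! ### Matrix rows and functionals on `M(ℓ²(A))` -/

/-- If `φ` has the same coefficients as `T : ℓ²(A) → A`, then `φ` is composition with `T`. -/
theorem comp_eq_leftMul_of_dualCoeff (T : Operator A (EllTwo A) A) (φ : MultiplierDual A)
    (h : ∀ i, dualCoeff φ i = T.comp (incl i)) (γ : Operator A A (EllTwo A))
    (hγ : IsAdjointable γ) : T.comp γ = leftMul (φ (ofOperator γ hγ)) := by
  have hrsmul : ∀ (δ : Operator A A (EllTwo A)) (hδ : IsAdjointable δ) (a : A),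
      φ (toMultiplierModule (δ a)) = φ (ofOperator δ hδ) * (a : 𝓜(ℂ, A)) := fun δ hδ a => by
    rw [← ofOperator_rsmul_coe δ hδ]
    exact φ.map_rsmul' _ _
  have hcoeff : ∀ i a, (φ (ofOperator (incl i) (isAdjointable_incl i))).fst a =
      T (single i a) := fun i a =>
    congrArg (fun R : Operator A A A => R a) (h i)
  -- For fixed `b`, both sides are continuous and linear in `x`, so it suffices to compare them on
  -- `single i a`, where `hrsmul` for `incl i` reduces the claim to equality of coefficients.
  have key : ∀ (b : A) (x : EllTwo A), (φ (toMultiplierModule x)).fst b = T x * b := by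
    intro b x
    let S₁ : EllTwo A →L[ℂ] A := LinearMap.mkContinuous
      { toFun := fun x => (φ (toMultiplierModule x)).fst b
        map_add' := fun x y => by simp
        map_smul' := fun c x => by simp }
      (‖φ.toContinuousLinearMap.comp (toMultiplierModule (A := A) (E := EllTwo A))‖ * ‖b‖)
      fun x => by
        refine (ContinuousLinearMap.le_opNorm _ b).trans ?_
        rw [DoubleCentralizer.norm_fst, mul_right_comm]
        gcongr
        exact ContinuousLinearMap.le_opNorm
          (φ.toContinuousLinearMap.comp (toMultiplierModule (A := A) (E := EllTwo A))) x
    let S₂ : EllTwo A →L[ℂ] A :=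
      ((ContinuousLinearMap.mul ℂ A).flip b).comp T.toContinuousLinearMap
    have hS : S₁ = S₂ := clm_ext_single fun i a => by
      change (φ (toMultiplierModule (incl i a))).fst b = T (incl i a) * b
      rw [hrsmul _ (isAdjointable_incl i), DoubleCentralizer.mul_fst]
      change (φ (ofOperator (incl i) (isAdjointable_incl i))).fst (a * b) = _
      rw [hcoeff]
      exact (T.comp (incl i)).map_rsmul' a b
    exact congrArg (fun R : EllTwo A →L[ℂ] A => R x) hS
  refine Operator.ext_apply fun a => ?_
  -- The two values will be compared after right multiplication by every `z`; taking stars turns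
  -- this into the left multiplication of the inner product.
  rw [← star_inj]
  refine ext_rinner_right (A := A) (E := A) fun z => ?_
  rw [← star_star (rinner A z _), ← star_star (rinner A z (star (leftMul _ a)))]
  congr 1
  simp only [rinner_self_def, star_mul, star_star]
  have h1 := key z (γ a)
  rw [hrsmul γ hγ, DoubleCentralizer.mul_fst] at h1
  exact h1.symm.trans ((leftMul (φ (ofOperator γ hγ))).map_rsmul' a z)

/-- Coordinatewise testing splits the claim into rows. A locally adjointable row is represented by
composition with it; a row represented by `φ` turns each adjointable `γ` into left multiplication by
`φ(γ)`. -/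
theorem isLocallyAdjointable_iff_belongsToMultiplierDual
    (F : Operator A (EllTwo A) (EllTwo A)) :
    IsLocallyAdjointable F ↔ ∀ k, BelongsToMultiplierDual (matrixRow F k) := by
  rw [isLocallyAdjointable_iff_proj]
  refine forall_congr' fun k => ⟨fun h => ⟨h.multiplierMap, ?_⟩, ?_⟩
  · exact funext fun i => Operator.ext_apply fun a => h.multiplierMap_fst _ a
  · rintro ⟨φ, hφ⟩ γ hγ
    rw [comp_eq_leftMul_of_dualCoeff _ φ (fun i => congrFun hφ i) γ hγ]
    exact isAdjointable_leftMul _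

end EllTwo

end HilbertModule

end

theorem mainTheorem4 {A : Type*} [NonUnitalCStarAlgebra A] [PartialOrder A] [StarOrderedRing A] :
    (∀ {E : Type*} [NormedAddCommGroup E] [NormedSpace ℂ E] [SMul Aᵐᵒᵖ E] [CStarModule Aᵐᵒᵖ E]
        [CompleteSpace E] (F : HilbertModule.Operator A E (HilbertModule.EllTwo A)),
      HilbertModule.IsLocallyAdjointable F ↔
        ∀ k : ℕ, HilbertModule.IsLocallyAdjointable ((HilbertModule.EllTwo.proj k).comp F)) ∧
    (∀ F : HilbertModule.Operator A (HilbertModule.EllTwo A) (HilbertModule.EllTwo A),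
      HilbertModule.IsLocallyAdjointable F ↔
        ∀ k : ℕ, HilbertModule.BelongsToMultiplierDual (HilbertModule.matrixRow F k)) := by
  exact ⟨fun F => HilbertModule.EllTwo.isLocallyAdjointable_iff_proj F,
    HilbertModule.EllTwo.isLocallyAdjointable_iff_belongsToMultiplierDual⟩
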